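/- A Boolean circuit in negation normal form has literals as inputs and $\wedge$- and $\vee$-gates of arbitrary fan-in; its size is its number of gates (inputs included). It is a deterministic DNNF if the subcircuits rooted in any two inputs of an $\wedge$-gate have disjoint variable sets, and no assignment makes two inputs of an $\vee$-gate true. An FBDD is a binary decision diagram (a directed acyclic graph with one source and two sinks labeled $0$ and $1$, whose other nodes are labeled with variables and have one outgoing $0$-edge and one outgoing $1$-edge) in which every variable appears at most once on every source-sink path; its size is its number of nodes. It is layered of width at most $w$ if its nodes can be partitioned into $L_1,\dots,L_s$ with $|L_i|\le w$ for all $i$ such that every edge goes from some $L_i$ to $L_{i+1}$. **Lemma.** There are constants $C, W, n_0\in\mathbb{N}$ and $c>0$ such that for every $n\ge 1$ there are a Boolean function $f_n$ on at most $Cn^2$ variables and a variable $x$ of $f_n$ such that 1. $f_n$ is computed by a layered FBDD of size at most $Cn^2$ and width at most $W$, and 2. if $n\ge n_0$, then every deterministic DNNF computing $\exists x\, f_n$ has size at least $2^{cn}$. -/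

import Mathlib

/-- The Boolean function `∃ x f`. It is written as a function of all variables of `f`; its value
does not depend on `x`. -/
def existsVar {V : Type*} [DecidableEq V] (x : V) (f : (V → Bool) → Bool) : (V → Bool) → Bool :=
  fun a => f (Function.update a x false) || f (Function.update a x true)

/-- Labels of the gates of a circuit in negation normal form with variables in `V` and gates in `G`:
a literal (`lit x true` is `x`, `lit x false` is `¬ x`), or an `∧`- or `∨`-gate of arbitrary fan-in
with its set of inputs. The constants `1` and `0` are the gates `and ∅` and `or ∅`. -/
inductive NNFLabel (V G : Type*) where
  | lit (x : V) (b : Bool)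
  | and (s : Finset G)
  | or (s : Finset G)

/-- The inputs of a gate with a given label. -/
def NNFLabel.inputs {V G : Type*} : NNFLabel V G → Finset G
  | .lit _ _ => ∅
  | .and s => s
  | .or s => s

/-- A Boolean circuit in negation normal form: a finite directed acyclic graph of gates with a
designated output gate. (On a finite set, acyclicity is well-foundedness of the input relation.) -/
structure NNF (V : Type*) where
  Gate : Type
  fintypeGate : Fintype Gate
  label : Gate → NNFLabel V Gate
  output : Gate
  acyclic : WellFounded fun h g : Gate => h ∈ (label g).inputs

namespace NNF

variable {V : Type*} (D : NNF V)

/-- `D.IsInput h g`: the gate `h` is an input (a child) of the gate `g`. -/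
def IsInput (h g : D.Gate) : Prop := h ∈ (D.label g).inputs

/-- The size of a circuit is the number of its gates, input gates included. -/
def size : ℕ := @Fintype.card D.Gate D.fintypeGate

/-- One evaluation step: the truth value of a gate with label `l`, given those of its inputs. -/
def stepTrue {G : Type} (a : V → Bool) (l : NNFLabel V G) (r : ∀ h, h ∈ l.inputs → Prop) : Prop :=
  match l, r with
  | .lit x b, _ => a x = b
  | .and _, r => ∀ h hh, r h hh
  | .or _, r => ∃ h hh, r h hh

/-- `D.GateTrue a g`: the gate `g` evaluates to true under the assignment `a`. -/
def GateTrue (a : V → Bool) : D.Gate → Prop :=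
  D.acyclic.fix fun g r => stepTrue a (D.label g) r

theorem gateTrue_eq (a : V → Bool) (g : D.Gate) :
    D.GateTrue a g = stepTrue a (D.label g) (fun h _ => D.GateTrue a h) :=
  D.acyclic.fix_eq _ g

theorem gateTrue_lit {a : V → Bool} {g : D.Gate} {x : V} {b : Bool}
    (hg : D.label g = .lit x b) : D.GateTrue a g ↔ a x = b := by
  rw [gateTrue_eq, hg]; rfl

theorem gateTrue_and {a : V → Bool} {g : D.Gate} {s : Finset D.Gate}
    (hg : D.label g = .and s) : D.GateTrue a g ↔ ∀ h ∈ s, D.GateTrue a h := by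
  rw [gateTrue_eq, hg]; rfl

theorem gateTrue_or {a : V → Bool} {g : D.Gate} {s : Finset D.Gate}
    (hg : D.label g = .or s) : D.GateTrue a g ↔ ∃ h ∈ s, D.GateTrue a h := by
  rw [gateTrue_eq, hg]; exact ⟨fun ⟨h, hh, t⟩ => ⟨h, hh, t⟩, fun ⟨h, hh, t⟩ => ⟨h, hh, t⟩⟩

/-- The circuit computes the Boolean function `f`. -/
def Computes (f : (V → Bool) → Bool) : Prop :=
  ∀ a, D.GateTrue a D.output ↔ f a = true

/-- The set of variables of the subcircuit rooted in the gate `g`. -/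
def vars (g : D.Gate) : Set V :=
  {x | ∃ h b, Relation.ReflTransGen D.IsInput h g ∧ D.label h = .lit x b}

/-- The subcircuits rooted in two different inputs of an `∧`-gate have disjoint variable sets. A
circuit with this property is a DNNF. -/
def IsDecomposable : Prop :=
  ∀ g s, D.label g = .and s → ∀ h₁ ∈ s, ∀ h₂ ∈ s, h₁ ≠ h₂ → Disjoint (D.vars h₁) (D.vars h₂)

/-- No assignment makes two different inputs of an `∨`-gate true. -/
def IsDeterministic : Prop :=
  ∀ g s, D.label g = .or s → ∀ h₁ ∈ s, ∀ h₂ ∈ s, h₁ ≠ h₂ →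
    ∀ a : V → Bool, ¬ (D.GateTrue a h₁ ∧ D.GateTrue a h₂)

/-- A deterministic DNNF (d-DNNF). -/
def IsDDNNF : Prop := D.IsDecomposable ∧ D.IsDeterministic

end NNF

/-- A binary decision diagram with variables in `V`. Its nodes are the decision nodes `.inl u`, each
with a variable and an outgoing edge for each value `b` of it, and the two sinks `.inr b`, labeled
with `b`. The graph is acyclic, and `source` is its only node without incoming edges. -/
structure BDD (V : Type*) where
  Decision : Type
  fintypeDecision : Fintype Decision
  var : Decision → V
  succ : Decision → Bool → Decision ⊕ Bool
  source : Decision ⊕ Bool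
  acyclic : WellFounded fun v u : Decision ⊕ Bool => ∃ d b, u = .inl d ∧ v = succ d b
  source_iff : ∀ v, v = source ↔ ¬ ∃ d b, v = succ d b

namespace BDD

variable {V : Type*} (B : BDD V)

/-- All nodes: decision nodes and sinks. -/
abbrev Node : Type := B.Decision ⊕ Bool

/-- There is an edge from `u` to `v`. -/
def Edge (u v : B.Node) : Prop := ∃ d b, u = .inl d ∧ v = B.succ d b

/-- The size of a BDD is the number of its nodes (there are two sinks). -/
def size : ℕ := @Fintype.card B.Decision B.fintypeDecision + 2

/-- The label of the sink that is reached from a node under the assignment `a`. -/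
def evalFrom (a : V → Bool) : B.Node → Bool :=
  B.acyclic.fix fun u r =>
    match u, r with
    | .inr b, _ => b
    | .inl d, r => r (B.succ d (a (B.var d))) ⟨d, _, rfl, rfl⟩

theorem evalFrom_sink (a : V → Bool) (b : Bool) : B.evalFrom a (.inr b) = b :=
  B.acyclic.fix_eq _ _

theorem evalFrom_decision (a : V → Bool) (d : B.Decision) :
    B.evalFrom a (.inl d) = B.evalFrom a (B.succ d (a (B.var d))) :=
  B.acyclic.fix_eq _ _

/-- The BDD computes the Boolean function `f`. -/
def Computes (f : (V → Bool) → Bool) : Prop :=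
  ∀ a, B.evalFrom a B.source = f a

/-- `p` is the list of nodes of a directed path from the source to a sink. -/
def IsSourceSinkPath (p : List B.Node) : Prop :=
  p.IsChain B.Edge ∧ p.head? = some B.source ∧ ∃ b, p.getLast? = some (.inr b)

/-- The variable of a node, if it is a decision node. -/
def nodeVar? (u : B.Node) : Option V := u.getLeft?.map B.var

/-- The BDD is free (an FBDD): on every source-sink path every variable appears at most once. -/
def IsFree : Prop :=
  ∀ p, B.IsSourceSinkPath p → (p.filterMap B.nodeVar?).Nodup

/-- The BDD is layered with width at most `w`: its nodes are partitioned into layers, the edges go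
from each layer to the next one only, and every layer has at most `w` nodes. -/
def IsLayeredOfWidthLE (w : ℕ) : Prop :=
  ∃ layer : B.Node → ℕ,
    (∀ u v, B.Edge u v → layer v = layer u + 1) ∧ ∀ i, {u | layer u = i}.ncard ≤ w

end BDD

/-! The function `f` is defined on a square grid of variables together with a selector `x`:
depending on `x`, it is the sum modulo 2, over all rows or over all columns, of the products of the
values of consecutive cells. A diagram of constant width reads the selector and then the grid row by
row or column by column.

For the lower bound, follow in a deterministic DNNF the gates that are true under a given assignment
as long as they contain more than two thirds of the variables. By decomposability and determinism
there is only one way to do so. The assignments for which this walk ends in a given way form a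
combinatorial rectangle with respect to a balanced partition of the variables, so that a circuit of
size `s` partitions its models into at most `s ^ 2` balanced rectangles.

Let `φ = φ₀ φ₁`, where `φ₀` and `φ₁` are the signs of the forms on the rows and on the columns. Then
`4 [∃ x, f] φ = 3 φ - φ₀ - φ₁ - 1`, and each term but the last has an exponentially small mean, so
that the models of `∃ x, f` have constant correlation with `φ`. On the other hand, a balanced
partition splits many rows or many columns. This gives a large induced matching between the two
parts of the grid graph, and hence the mean of `φ` over any rectangle of this partition is
exponentially small. So exponentially many rectangles are needed.
-/

/-! ### Balanced rectangles in deterministic DNNFs -/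

/-- The partition of the variables into `Y` and its complement is balanced: each of the two parts
has at least one third of all variables. -/
def IsBalanced {V : Type*} [Fintype V] (Y : Finset V) : Prop :=
  Fintype.card V ≤ 3 * Y.card ∧ 3 * Y.card ≤ 2 * Fintype.card V

/-- A combinatorial rectangle with respect to the partition of the variables into `Y` and its
complement: a set of assignments that is closed under combining the restriction to `Y` of one member
with the restriction to the complement of another. -/
def IsRectangle {V : Type*} (Y : Finset V) (S : Set (V → Bool)) : Prop :=
  ∀ a ∈ S, ∀ b ∈ S, ∀ c, Set.EqOn c a Y → Set.EqOn c b (Y : Set V)ᶜ → c ∈ S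

/-- A combinatorial rectangle with respect to some balanced partition of the variables. -/
def IsBalancedRectangle {V : Type*} [Fintype V] (S : Set (V → Bool)) : Prop :=
  ∃ Y, IsBalanced Y ∧ IsRectangle Y S

section Balanced

variable {V : Type*} [Fintype V]

theorem exists_isBalanced_between (hV : 2 ≤ Fintype.card V) {A B : Finset V} (hAB : A ⊆ B)
    (hA : 3 * A.card ≤ 2 * Fintype.card V) (hB : 2 * Fintype.card V ≤ 3 * B.card) :
    ∃ Y, A ⊆ Y ∧ Y ⊆ B ∧ IsBalanced Y := by
  obtain ⟨Y, hAY, hYB, hY⟩ := Finset.exists_subsuperset_card_eq hAB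
    (n := max A.card ((Fintype.card V + 2) / 3)) (le_max_left _ _)
    (max_le (Finset.card_le_card hAB) (by omega))
  exact ⟨Y, hAY, hYB, by omega, by omega⟩

theorem exists_isBalanced_superset (hV : 2 ≤ Fintype.card V) {A : Finset V}
    (hA : 3 * A.card ≤ 2 * Fintype.card V) : ∃ Y, A ⊆ Y ∧ IsBalanced Y := by
  obtain ⟨Y, hAY, -, hY⟩ := exists_isBalanced_between hV A.subset_univ hA
    (by rw [Finset.card_univ]; omega)
  exact ⟨Y, hAY, hY⟩

/-- Adding the sets one by one, the union cannot jump over the middle third: below one third, a set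
with less than one third adds too little. -/
theorem exists_isBalanced_biUnion [DecidableEq V] {ι : Type*} (A : ι → Finset V)
    (s : Finset ι) (hA : ∀ i ∈ s, 3 * (A i).card ≤ 2 * Fintype.card V)
    (hs : Fintype.card V ≤ 3 * (s.biUnion A).card) :
    ∃ t ⊆ s, IsBalanced (t.biUnion A) := by
  classical
  induction s using Finset.induction_on with
  | empty => exact ⟨∅, subset_rfl, hs, by simp⟩
  | insert i s _ ih =>
    by_cases hlarge : Fintype.card V ≤ 3 * (s.biUnion A).card
    · obtain ⟨t, ht, hbal⟩ := ih (fun j hj => hA j (Finset.mem_insert_of_mem hj)) hlarge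
      exact ⟨t, ht.trans (Finset.subset_insert _ _), hbal⟩
    by_cases hi : Fintype.card V ≤ 3 * (A i).card
    · exact ⟨{i}, by simp, by simpa using hi, by simpa using hA i (Finset.mem_insert_self _ _)⟩
    · refine ⟨insert i s, subset_rfl, hs, ?_⟩
      have := Finset.card_union_le (A i) (s.biUnion A)
      rw [Finset.biUnion_insert]
      omega

end Balanced

namespace NNF

variable {V : Type*} {D : NNF V} {a b c : V → Bool} {g h k : D.Gate} {s : Finset D.Gate}

theorem not_isInput_of_lit {x : V} {v : Bool} (hg : D.label g = .lit x v) : ¬ D.IsInput h g := by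
  simp [IsInput, hg, NNFLabel.inputs]

theorem isInput_and (hg : D.label g = .and s) : D.IsInput h g ↔ h ∈ s := by
  simp [IsInput, hg, NNFLabel.inputs]

theorem isInput_or (hg : D.label g = .or s) : D.IsInput h g ↔ h ∈ s := by
  simp [IsInput, hg, NNFLabel.inputs]

theorem vars_subset (hh : D.IsInput h g) : D.vars h ⊆ D.vars g :=
  fun _ ⟨k, v, hk, hl⟩ => ⟨k, v, hk.tail hh, hl⟩

theorem vars_lit {x : V} {v : Bool} (hg : D.label g = .lit x v) : D.vars g = {x} := by
  ext y
  constructor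
  · rintro ⟨h, w, hreach, hl⟩
    rcases hreach.cases_tail with rfl | ⟨k, -, hk⟩
    · cases hg.symm.trans hl
      rfl
    · exact absurd hk (not_isInput_of_lit hg)
  · rintro rfl
    exact ⟨g, v, .refl, hg⟩

theorem vars_and (hg : D.label g = .and s) : D.vars g = ⋃ h ∈ s, D.vars h := by
  apply Set.Subset.antisymm
  · rintro x ⟨h, v, hreach, hl⟩
    rcases hreach.cases_tail with rfl | ⟨k, hhk, hk⟩
    · cases hg.symm.trans hl
    · exact Set.mem_biUnion ((isInput_and hg).1 hk) ⟨h, v, hhk, hl⟩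
  · exact Set.iUnion₂_subset fun h hh => vars_subset ((isInput_and hg).2 hh)

theorem gateTrue_congr (hab : Set.EqOn a b (D.vars g)) : D.GateTrue a g ↔ D.GateTrue b g := by
  induction g using D.acyclic.induction with
  | _ g ih =>
    have hinput (h : D.Gate) (hh : D.IsInput h g) : D.GateTrue a h ↔ D.GateTrue b h :=
      ih h hh (hab.mono (vars_subset hh))
    cases hg : D.label g with
    | lit x v => rw [gateTrue_lit D hg, gateTrue_lit D hg, hab (by simp [vars_lit hg])]
    | and s =>
      rw [gateTrue_and D hg, gateTrue_and D hg]
      exact forall₂_congr fun h hh => hinput h ((isInput_and hg).2 hh)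
    | or s =>
      rw [gateTrue_or D hg, gateTrue_or D hg]
      exact exists_congr fun h => and_congr_right fun hh => hinput h ((isInput_or hg).2 hh)

theorem IsDecomposable.gateTrue_of_isInput (hD : D.IsDecomposable) (hh : D.IsInput h g)
    (hg : D.GateTrue b g) (hc : D.GateTrue c h) (hcb : Set.EqOn c b (D.vars h)ᶜ) :
    D.GateTrue c g := by
  cases hl : D.label g with
  | lit x v => exact absurd hh (not_isInput_of_lit hl)
  | and s =>
    rw [isInput_and hl] at hh
    rw [gateTrue_and D hl] at hg ⊢
    intro k hk
    by_cases hkh : k = h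
    · exact hkh ▸ hc
    · have hdisj : D.vars k ⊆ (D.vars h)ᶜ := (hD g s hl k hk h hh hkh).subset_compl_right
      exact (gateTrue_congr (hcb.mono hdisj)).2 (hg k hk)
  | or s => exact (gateTrue_or D hl).2 ⟨h, (isInput_or hl).1 hh, hc⟩

variable [Fintype V]

open Classical in
/-- The set `D.vars g` of the variables below a gate, as a finite set. -/
noncomputable def varFinset (D : NNF V) (g : D.Gate) : Finset V := (D.vars g).toFinset

@[simp]
theorem coe_varFinset : (D.varFinset g : Set V) = D.vars g := by simp [varFinset]

theorem varFinset_subset (hh : D.IsInput h g) : D.varFinset h ⊆ D.varFinset g := by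
  simpa [← Finset.coe_subset] using vars_subset hh

theorem varFinset_and [DecidableEq V] (hg : D.label g = .and s) :
    D.varFinset g = s.biUnion D.varFinset := by
  simp [← Finset.coe_inj, vars_and hg]

theorem IsDecomposable.disjoint_varFinset (hD : D.IsDecomposable) (hg : D.label g = .and s)
    (hh : h ∈ s) (hk : k ∈ s) (hne : h ≠ k) : Disjoint (D.varFinset h) (D.varFinset k) := by
  simpa [← Finset.disjoint_coe] using hD g s hg h hh k hk hne

/-- A gate whose subcircuit contains more than two thirds of all variables. -/
def IsHeavy (D : NNF V) (g : D.Gate) : Prop := 2 * Fintype.card V < 3 * (D.varFinset g).card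

theorem IsHeavy.label_ne_lit (hV : 2 ≤ Fintype.card V) (hg : D.IsHeavy g) (x : V) (v : Bool) :
    D.label g ≠ .lit x v := by
  intro hl
  have hvars : D.varFinset g = {x} := by simp [← Finset.coe_inj, vars_lit hl]
  rw [IsHeavy, hvars, Finset.card_singleton] at hg
  omega

theorem IsDecomposable.eq_of_isHeavy (hD : D.IsDecomposable) (hg : D.label g = .and s)
    (hh : h ∈ s) (hk : k ∈ s) (hhHeavy : D.IsHeavy h) (hkHeavy : D.IsHeavy k) : h = k := by
  classical
  by_contra hne
  have hcard := (D.varFinset h ∪ D.varFinset k).card_le_univ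
  rw [Finset.card_union_of_disjoint (hD.disjoint_varFinset hg hh hk hne)] at hcard
  unfold IsHeavy at hhHeavy hkHeavy
  omega

/-- One step of the walk that follows true heavy gates: the gates `g` and `h` are true under `a`,
and `h` is a heavy input of `g`. -/
def HeavyStep (D : NNF V) (a : V → Bool) (g h : D.Gate) : Prop :=
  D.GateTrue a g ∧ D.GateTrue a h ∧ D.IsInput h g ∧ D.IsHeavy h

/-- The gate `g` is reached from the output, which is true under `a`, through true heavy gates. -/
def HeavyReach (D : NNF V) (a : V → Bool) (g : D.Gate) : Prop :=
  D.GateTrue a D.output ∧ Relation.ReflTransGen (D.HeavyStep a) D.output g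

theorem HeavyReach.gateTrue (hg : D.HeavyReach a g) : D.GateTrue a g := by
  rcases hg.2.cases_tail with heq | ⟨_, -, hstep⟩
  · exact heq ▸ hg.1
  · exact hstep.2.1

theorem HeavyReach.isHeavy (ho : D.IsHeavy D.output) (hg : D.HeavyReach a g) : D.IsHeavy g := by
  rcases hg.2.cases_tail with heq | ⟨_, -, hstep⟩
  · exact heq ▸ ho
  · exact hstep.2.2.2

theorem IsDDNNF.rightUnique_heavyStep (hD : D.IsDDNNF) (a : V → Bool) :
    Relator.RightUnique (D.HeavyStep a) := by
  rintro g h k ⟨-, hTrue, hInput, hHeavy⟩ ⟨-, kTrue, kInput, kHeavy⟩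
  cases hg : D.label g with
  | lit x v => exact absurd hInput (not_isInput_of_lit hg)
  | and s =>
    rw [isInput_and hg] at hInput kInput
    exact hD.1.eq_of_isHeavy hg hInput kInput hHeavy kHeavy
  | or s =>
    rw [isInput_or hg] at hInput kInput
    by_contra hne
    exact hD.2 g s hg h hInput k kInput hne a ⟨hTrue, kTrue⟩

theorem IsDecomposable.heavyReach_congr (hD : D.IsDecomposable) (hb : D.HeavyReach b g)
    (hc : D.GateTrue c g) (hcb : Set.EqOn c b (D.vars g)ᶜ) : D.HeavyReach c g := by
  obtain ⟨-, hreach⟩ := hb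
  induction hreach with
  | refl => exact ⟨hc, .refl⟩
  | @tail g h _ hstep ih =>
    obtain ⟨hg, -, hInput, hHeavy⟩ := hstep
    have hcg : D.GateTrue c g := hD.gateTrue_of_isInput hInput hg hc hcb
    have hcr : D.HeavyReach c g :=
      ih hcg (hcb.mono (Set.compl_subset_compl.2 (vars_subset hInput)))
    exact ⟨hcr.1, hcr.2.tail ⟨hcg, hc, hInput, hHeavy⟩⟩

/-- The walk through true heavy gates ends in `g`. There are two ways to end: either `g` is an
`∨`-gate and `h` is its true input, which is not heavy, or `g` is an `∧`-gate without heavy inputs;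
in the second case `h` carries no information and is set to `g`. -/
def HeavyEnd (D : NNF V) (a : V → Bool) (g h : D.Gate) : Prop :=
  D.HeavyReach a g ∧
    match D.label g with
    | .lit _ _ => False
    | .and s => h = g ∧ ∀ k ∈ s, ¬ D.IsHeavy k
    | .or s => h ∈ s ∧ D.GateTrue a h ∧ ¬ D.IsHeavy h

theorem heavyEnd_and (hg : D.label g = .and s) :
    D.HeavyEnd a g h ↔ D.HeavyReach a g ∧ h = g ∧ ∀ k ∈ s, ¬ D.IsHeavy k := by
  rw [HeavyEnd, hg]

theorem heavyEnd_or (hg : D.label g = .or s) :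
    D.HeavyEnd a g h ↔ D.HeavyReach a g ∧ h ∈ s ∧ D.GateTrue a h ∧ ¬ D.IsHeavy h := by
  rw [HeavyEnd, hg]

theorem not_heavyEnd_of_lit {x : V} {v : Bool} (hg : D.label g = .lit x v) :
    ¬ D.HeavyEnd a g h := by
  simp [HeavyEnd, hg]

theorem HeavyEnd.not_heavyStep (hD : D.IsDeterministic) (he : D.HeavyEnd a g h) :
    ¬ D.HeavyStep a g k := by
  rintro ⟨-, kTrue, kInput, kHeavy⟩
  cases hg : D.label g with
  | lit x v => exact not_isInput_of_lit hg kInput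
  | and s => exact ((heavyEnd_and hg).1 he).2.2 k ((isInput_and hg).1 kInput) kHeavy
  | or s =>
    obtain ⟨-, hh, hTrue, hLight⟩ := (heavyEnd_or hg).1 he
    have hkh : k ≠ h := fun heq => hLight (heq ▸ kHeavy)
    exact hD g s hg k ((isInput_or hg).1 kInput) h hh hkh a ⟨kTrue, hTrue⟩

theorem HeavyEnd.eq_of_reflTransGen (hD : D.IsDeterministic) (he : D.HeavyEnd a g h)
    (hgk : Relation.ReflTransGen (D.HeavyStep a) g k) : g = k :=
  hgk.cases_head.resolve_right fun ⟨_, hstep, _⟩ => he.not_heavyStep hD hstep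

theorem HeavyEnd.unique (hD : D.IsDDNNF) {g' h' : D.Gate} (he : D.HeavyEnd a g h)
    (he' : D.HeavyEnd a g' h') : g = g' ∧ h = h' := by
  obtain rfl : g = g' := by
    rcases Relation.ReflTransGen.total_of_right_unique (hD.rightUnique_heavyStep a)
      he.1.2 he'.1.2 with hgg' | hg'g
    · exact he.eq_of_reflTransGen hD.2 hgg'
    · exact (he'.eq_of_reflTransGen hD.2 hg'g).symm
  refine ⟨rfl, ?_⟩
  cases hg : D.label g with
  | lit x v => exact absurd he (not_heavyEnd_of_lit hg)
  | and s => exact ((heavyEnd_and hg).1 he).2.1.trans ((heavyEnd_and hg).1 he').2.1.symm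
  | or s =>
    obtain ⟨-, hh, hTrue, -⟩ := (heavyEnd_or hg).1 he
    obtain ⟨-, hh', hTrue', -⟩ := (heavyEnd_or hg).1 he'
    by_contra hne
    exact hD.2 g s hg h hh h' hh' hne a ⟨hTrue, hTrue'⟩

theorem exists_heavyEnd (hV : 2 ≤ Fintype.card V) (ho : D.IsHeavy D.output)
    (ha : D.GateTrue a D.output) : ∃ g h, D.HeavyEnd a g h := by
  obtain ⟨g, hreach, hmin⟩ := D.acyclic.has_min {g | D.HeavyReach a g} ⟨D.output, ha, .refl⟩
  have hlast (h : D.Gate) (hInput : D.IsInput h g) (hTrue : D.GateTrue a h) : ¬ D.IsHeavy h :=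
    fun hHeavy => hmin h ⟨ha, hreach.2.tail ⟨hreach.gateTrue, hTrue, hInput, hHeavy⟩⟩ hInput
  cases hg : D.label g with
  | lit x v => exact absurd hg ((hreach.isHeavy ho).label_ne_lit hV x v)
  | and s =>
    refine ⟨g, g, (heavyEnd_and hg).2 ⟨hreach, rfl, fun k hk => ?_⟩⟩
    exact hlast k ((isInput_and hg).2 hk) ((gateTrue_and D hg).1 hreach.gateTrue k hk)
  | or s =>
    obtain ⟨h, hh, hTrue⟩ := (gateTrue_or D hg).1 hreach.gateTrue
    exact ⟨g, h, (heavyEnd_or hg).2 ⟨hreach, hh, hTrue, hlast h ((isInput_or hg).2 hh) hTrue⟩⟩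

/-- Take `Y` between the variables of the light gate `h` and those of the heavy gate `g`: the truth
of `h` depends only on `Y`, and given that `h` is true, reaching `g` depends only on the
complement. -/
theorem IsDecomposable.isBalancedRectangle_heavyEnd_or (hD : D.IsDecomposable)
    (hV : 2 ≤ Fintype.card V) (hg : D.label g = .or s) (hh : h ∈ s) (hgHeavy : D.IsHeavy g)
    (hhLight : ¬ D.IsHeavy h) : IsBalancedRectangle {a | D.HeavyEnd a g h} := by
  obtain ⟨Y, hhY, hYg, hY⟩ := exists_isBalanced_between hV
    (varFinset_subset ((isInput_or hg).2 hh)) (not_lt.1 hhLight) hgHeavy.le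
  rw [← Finset.coe_subset, coe_varFinset] at hhY hYg
  refine ⟨Y, hY, fun a ha b hb c hca hcb => ?_⟩
  obtain ⟨-, -, haTrue, -⟩ := (heavyEnd_or hg).1 ha
  have hcTrue : D.GateTrue c h := (gateTrue_congr (hca.mono hhY)).2 haTrue
  have hcReach : D.HeavyReach c g := hD.heavyReach_congr hb.1
    ((gateTrue_or D hg).2 ⟨h, hh, hcTrue⟩) (hcb.mono (Set.compl_subset_compl.2 hYg))
  exact (heavyEnd_or hg).2 ⟨hcReach, hh, hcTrue, hhLight⟩

/-- Take for `Y` the variables of a suitable set of inputs of `g`: by decomposability, these inputs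
depend only on `Y` and the other ones only on the complement. -/
theorem IsDecomposable.isBalancedRectangle_heavyEnd_and (hD : D.IsDecomposable)
    (hg : D.label g = .and s) (hgHeavy : D.IsHeavy g) (hLight : ∀ k ∈ s, ¬ D.IsHeavy k) :
    IsBalancedRectangle {a | D.HeavyEnd a g g} := by
  classical
  obtain ⟨t, hts, hY⟩ := exists_isBalanced_biUnion D.varFinset s
    (fun k hk => not_lt.1 (hLight k hk))
    (by rw [← varFinset_and hg]; unfold IsHeavy at hgHeavy; omega)
  refine ⟨_, hY, fun a ha b hb c hca hcb => (heavyEnd_and hg).2 ⟨?_, rfl, hLight⟩⟩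
  have haTrue := (gateTrue_and D hg).1 ha.1.gateTrue
  have hbTrue := (gateTrue_and D hg).1 hb.1.gateTrue
  simp only [Finset.coe_biUnion, coe_varFinset] at hca hcb
  refine hD.heavyReach_congr hb.1 ((gateTrue_and D hg).2 fun k hk => ?_) (hcb.mono ?_)
  · by_cases hkt : k ∈ t
    · exact (gateTrue_congr (hca.mono (Set.subset_biUnion_of_mem hkt))).2 (haTrue k hk)
    · have hdisj : D.vars k ⊆ (⋃ k' ∈ t, D.vars k')ᶜ := by
        refine (Set.disjoint_iUnion₂_right.2 fun k' hk' => ?_).subset_compl_right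
        exact hD g s hg k hk k' (hts hk') fun heq => hkt (heq ▸ hk')
      exact (gateTrue_congr (hcb.mono hdisj)).2 (hbTrue k hk)
  · rw [vars_and hg]
    exact Set.compl_subset_compl.2 (Set.biUnion_subset_biUnion_left hts)

theorem IsDecomposable.isBalancedRectangle_heavyEnd (hD : D.IsDecomposable)
    (hV : 2 ≤ Fintype.card V) (ho : D.IsHeavy D.output) (g h : D.Gate) :
    IsBalancedRectangle {a | D.HeavyEnd a g h} := by
  rcases Set.eq_empty_or_nonempty {a | D.HeavyEnd a g h} with hempty | ⟨a, ha⟩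
  · obtain ⟨Y, -, hY⟩ := exists_isBalanced_superset hV (A := ∅) (by simp)
    exact ⟨Y, hY, by simp [hempty, IsRectangle]⟩
  have hgHeavy := ha.1.isHeavy ho
  cases hg : D.label g with
  | lit x v => exact absurd ha (not_heavyEnd_of_lit hg)
  | and s =>
    obtain ⟨-, rfl, hLight⟩ := (heavyEnd_and hg).1 ha
    exact hD.isBalancedRectangle_heavyEnd_and hg hgHeavy hLight
  | or s =>
    obtain ⟨-, hh, -, hLight⟩ := (heavyEnd_or hg).1 ha
    exact hD.isBalancedRectangle_heavyEnd_or hV hg hh hgHeavy hLight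

theorem isBalancedRectangle_gateTrue_of_not_isHeavy (hV : 2 ≤ Fintype.card V)
    (hg : ¬ D.IsHeavy g) : IsBalancedRectangle {a | D.GateTrue a g} := by
  obtain ⟨Y, hgY, hY⟩ := exists_isBalanced_superset hV (not_lt.1 hg)
  rw [← Finset.coe_subset, coe_varFinset] at hgY
  exact ⟨Y, hY, fun a ha _ _ c hca _ => (gateTrue_congr (hca.mono hgY)).2 ha⟩

theorem IsDDNNF.exists_balancedRectangle_partition (hD : D.IsDDNNF) (hV : 2 ≤ Fintype.card V) :
    ∃ S : D.Gate × D.Gate → Set (V → Bool), (∀ t, IsBalancedRectangle (S t)) ∧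
      Pairwise (Function.onFun Disjoint S) ∧ ⋃ t, S t = {a | D.GateTrue a D.output} := by
  by_cases ho : D.IsHeavy D.output
  · refine ⟨fun t => {a | D.HeavyEnd a t.1 t.2},
      fun t => hD.1.isBalancedRectangle_heavyEnd hV ho t.1 t.2, fun t t' hne => ?_, ?_⟩
    · refine Set.disjoint_left.2 fun a ha ha' => hne ?_
      exact Prod.ext_iff.2 (HeavyEnd.unique hD ha ha')
    · ext a
      simp only [Set.mem_iUnion, Set.mem_ofPred_eq, Prod.exists]
      exact ⟨fun ⟨_, _, he⟩ => he.1.1, exists_heavyEnd hV ho⟩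
  · refine ⟨fun t => {a | D.GateTrue a D.output ∧ t = (D.output, D.output)}, fun t => ?_,
      fun t t' hne => ?_, ?_⟩
    · by_cases ht : t = (D.output, D.output)
      · simpa [ht] using isBalancedRectangle_gateTrue_of_not_isHeavy hV ho
      · obtain ⟨Y, -, hY⟩ := exists_isBalanced_superset hV (A := ∅) (by simp)
        exact ⟨Y, hY, by simp [ht, IsRectangle]⟩
    · exact Set.disjoint_left.2 fun a ha ha' => hne (ha.2.trans ha'.2.symm)
    · ext a
      simp

theorem IsDDNNF.abs_sum_indicator_le [DecidableEq V] (hD : D.IsDDNNF) (hV : 2 ≤ Fintype.card V)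
    {φ : (V → Bool) → ℤ} {δ : ℤ}
    (hφ : ∀ S, IsBalancedRectangle S → |∑ a, S.indicator φ a| ≤ δ) :
    |∑ a, {a | D.GateTrue a D.output}.indicator φ a| ≤ D.size ^ 2 * δ := by
  classical
  let := D.fintypeGate
  obtain ⟨S, hS, hdisj, hunion⟩ := hD.exists_balancedRectangle_partition hV
  have hsplit : ∑ a, {a | D.GateTrue a D.output}.indicator φ a =
      ∑ t, ∑ a, (S t).indicator φ a := by
    rw [← hunion, Finset.sum_comm]
    refine Finset.sum_congr rfl fun a _ => ?_
    simpa using congrFun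
      (Finset.indicator_biUnion Finset.univ S (f := φ) fun t _ t' _ hne => hdisj hne) a
  calc |∑ a, {a | D.GateTrue a D.output}.indicator φ a|
      ≤ ∑ t, |∑ a, (S t).indicator φ a| := hsplit ▸ Finset.abs_sum_le_sum_abs _ _
    _ ≤ ∑ _t : D.Gate × D.Gate, δ := Finset.sum_le_sum fun t _ => hφ _ (hS t)
    _ = D.size ^ 2 * δ := by simp [NNF.size, sq]

end NNF

/-! ### Signs of quadratic forms on rectangles -/

section Discrepancy

theorem sq_sum_sum_le_card_mul {α β R : Type*} [Fintype α] [Fintype β] [CommRing R] [LinearOrder R]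
    [IsStrictOrderedRing R] (F : α → β → R) (A : Finset α) (B : Finset β) :
    (∑ a ∈ A, ∑ b ∈ B, F a b) ^ 2 ≤ Fintype.card α * ∑ b, ∑ b', |∑ a, F a b * F a b'| :=
  calc (∑ a ∈ A, ∑ b ∈ B, F a b) ^ 2
      ≤ A.card * ∑ a ∈ A, (∑ b ∈ B, F a b) ^ 2 := sq_sum_le_card_mul_sum_sq
    _ ≤ Fintype.card α * ∑ a, (∑ b ∈ B, F a b) ^ 2 := by
      gcongr
      · exact A.card_le_univ
      · exact A.subset_univ
    _ = Fintype.card α * ∑ b ∈ B, ∑ b' ∈ B, ∑ a, F a b * F a b' := by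
      simp only [sq, Finset.sum_mul_sum]
      rw [Finset.sum_comm]
      exact congrArg _ (Finset.sum_congr rfl fun b _ => Finset.sum_comm)
    _ ≤ Fintype.card α * ∑ b ∈ B, ∑ b' ∈ B, |∑ a, F a b * F a b'| := by
      gcongr
      exact le_abs_self _
    _ ≤ Fintype.card α * ∑ b, ∑ b', |∑ a, F a b * F a b'| := by
      gcongr
      refine (Finset.sum_le_univ_sum_of_nonneg fun b => Finset.sum_nonneg fun b' _ =>
        abs_nonneg _).trans ?_
      gcongr
      exact B.subset_univ

variable {V : Type*} [DecidableEq V] {Y : Finset V}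

theorem IsRectangle.exists_piecewise_mem_iff {S : Set (V → Bool)} (hS : IsRectangle Y S) :
    ∃ A B : Set (V → Bool), ∀ a b, Y.piecewise a b ∈ S ↔ a ∈ A ∧ b ∈ B := by
  refine ⟨{a | ∃ b, Y.piecewise a b ∈ S}, {b | ∃ a, Y.piecewise a b ∈ S}, fun a b =>
    ⟨fun h => ⟨⟨b, h⟩, ⟨a, h⟩⟩, fun ⟨⟨b', hb'⟩, ⟨a', ha'⟩⟩ => ?_⟩⟩
  refine hS _ hb' _ ha' _ (fun x hx => ?_) (fun x hx => ?_)
  · simp [Finset.mem_coe.1 hx]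
  · simp [show x ∉ Y from hx]

variable [Fintype V]

theorem sum_sum_piecewise {R : Type*} [CommSemiring R] (Y : Finset V) (F : (V → Bool) → R) :
    ∑ a, ∑ b, F (Y.piecewise a b) = 2 ^ Fintype.card V * ∑ a, F a := by
  have hinv : Function.Involutive fun p : (V → Bool) × (V → Bool) =>
      (Y.piecewise p.1 p.2, Y.piecewise p.2 p.1) := by
    rintro ⟨a, b⟩
    refine Prod.ext ?_ ?_ <;> (ext x; by_cases hx : x ∈ Y <;> simp [hx])
  calc ∑ a, ∑ b, F (Y.piecewise a b)
      = ∑ p : (V → Bool) × (V → Bool), F (Y.piecewise p.1 p.2) :=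
        (Fintype.sum_prod_type' fun a b => F (Y.piecewise a b)).symm
    _ = ∑ p : (V → Bool) × (V → Bool), F p.1 := Equiv.sum_comp hinv.toPerm fun p => F p.1
    _ = 2 ^ Fintype.card V * ∑ a, F a := by simp [Fintype.sum_prod_type, Finset.mul_sum]

theorem IsRectangle.sq_sum_indicator_le {S : Set (V → Bool)} (hS : IsRectangle Y S)
    (φ : (V → Bool) → ℤ) :
    2 ^ Fintype.card V * (∑ a, S.indicator φ a) ^ 2 ≤
      ∑ b, ∑ b', |∑ a, φ (Y.piecewise a b) * φ (Y.piecewise a b')| := by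
  classical
  obtain ⟨A, B, hAB⟩ := hS.exists_piecewise_mem_iff
  have hsum : 2 ^ Fintype.card V * ∑ a, S.indicator φ a =
      ∑ a with a ∈ A, ∑ b with b ∈ B, φ (Y.piecewise a b) := by
    rw [← sum_sum_piecewise Y, Finset.sum_filter]
    refine Finset.sum_congr rfl fun a _ => ?_
    by_cases ha : a ∈ A <;> simp [Set.indicator_apply, hAB, ha, Finset.sum_filter]
  have hcs := sq_sum_sum_le_card_mul (fun a b => φ (Y.piecewise a b)) {a | a ∈ A} {b | b ∈ B}
  refine le_of_mul_le_mul_left (a := (2 : ℤ) ^ Fintype.card V) ?_ (by positivity)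
  calc (2 : ℤ) ^ Fintype.card V * (2 ^ Fintype.card V * (∑ a, S.indicator φ a) ^ 2)
      = (2 ^ Fintype.card V * ∑ a, S.indicator φ a) ^ 2 := by ring
    _ ≤ _ := by simpa [hsum] using hcs

omit [DecidableEq V] in
theorem card_mul_two_pow_le_of_eqOn_compl (T : Finset (V → Bool)) (W : Finset V)
    (hT : ∀ b ∈ T, ∀ b' ∈ T, Set.EqOn b b' (W : Set V)ᶜ → b = b') :
    T.card * 2 ^ W.card ≤ 2 ^ Fintype.card V := by
  classical
  have hcard : T.card ≤ Fintype.card ({x // x ∉ W} → Bool) := by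
    rw [← Finset.card_univ]
    refine Finset.card_le_card_of_injOn (fun b x => b x.1) (fun _ _ => Finset.mem_univ _) ?_
    exact fun b hb b' hb' h => hT b hb b' hb' fun x hx => congrFun h ⟨x, hx⟩
  calc T.card * 2 ^ W.card ≤ 2 ^ (Fintype.card V - W.card) * 2 ^ W.card := by
        gcongr
        simpa [Fintype.card_subtype_compl] using hcard
    _ = 2 ^ Fintype.card V := by rw [← pow_add, Nat.sub_add_cancel W.card_le_univ]

end Discrepancy

/-- The value `true` as `-1` and `false` as `1`, so that `xor` becomes multiplication. -/
def boolSign (b : Bool) : ℤ := if b then -1 else 1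

theorem boolSign_mul_self (b : Bool) : boolSign b * boolSign b = 1 := by
  cases b <;> rfl

theorem boolSign_xor (a b : Bool) : boolSign (xor a b) = boolSign a * boolSign b := by
  cases a <;> cases b <;> rfl

theorem boolSign_injective : Function.Injective boolSign := by
  decide

/-- The sign of the product of the values of the two end points of an edge. -/
def edgeSign {V : Type*} (a : V → Bool) : Sym2 V → ℤ :=
  Sym2.lift ⟨fun x y => boolSign (a x && a y), fun _ _ => congrArg boolSign (Bool.and_comm _ _)⟩

@[simp]
theorem edgeSign_mk {V : Type*} (a : V → Bool) (x y : V) :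
    edgeSign a s(x, y) = boolSign (a x && a y) := rfl

theorem edgeSign_mul_self {V : Type*} (a : V → Bool) (e : Sym2 V) :
    edgeSign a e * edgeSign a e = 1 := by
  induction e with
  | _ x y => exact boolSign_mul_self _

theorem edgeSign_congr {V : Type*} {a b : V → Bool} {e : Sym2 V} (h : ∀ x ∈ e, a x = b x) :
    edgeSign a e = edgeSign b e := by
  induction e with
  | _ x y => rw [edgeSign_mk, edgeSign_mk, h x (by simp), h y (by simp)]

/-- The sign of the quadratic form over `𝔽₂` whose monomials `x y` are the edges of the graph with
edge set `E`. -/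
def graphSign {V : Type*} (E : Finset (Sym2 V)) (a : V → Bool) : ℤ := ∏ e ∈ E, edgeSign a e

theorem graphSign_mul_self {V : Type*} (E : Finset (Sym2 V)) (a : V → Bool) :
    graphSign E a * graphSign E a = 1 := by
  rw [graphSign, ← Finset.prod_mul_distrib]
  exact Finset.prod_eq_one fun e _ => edgeSign_mul_self a e

theorem abs_graphSign {V : Type*} (E : Finset (Sym2 V)) (a : V → Bool) : |graphSign E a| = 1 :=
  Int.isUnit_iff_abs_eq.1 (.of_mul_eq_one _ (graphSign_mul_self E a))

theorem graphSign_congr {V : Type*} {E : Finset (Sym2 V)} {a b : V → Bool}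
    (h : ∀ e ∈ E, ∀ x ∈ e, a x = b x) : graphSign E a = graphSign E b :=
  Finset.prod_congr rfl fun e he => edgeSign_congr (h e he)

section GraphSign

variable {V : Type*} [DecidableEq V]

/-- The assignment `a` with the value of the variable `u` negated. -/
def flipVar (u : V) (a : V → Bool) : V → Bool := Function.update a u (!a u)

theorem flipVar_involutive (u : V) : Function.Involutive (flipVar u) := by
  intro a
  simp [flipVar]

theorem piecewise_flipVar {Y : Finset V} {u : V} (hu : u ∈ Y) (a b : V → Bool) :
    Y.piecewise (flipVar u a) b = flipVar u (Y.piecewise a b) := by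
  simp [flipVar, Finset.update_piecewise_of_mem, hu]

/-- The sign of the sum modulo 2 of the values of the neighbors of `u` in the set `W`. -/
def nbrSign (E : Finset (Sym2 V)) (W : Finset V) (u : V) (a : V → Bool) : ℤ :=
  ∏ w ∈ W with s(u, w) ∈ E, boolSign (a w)

variable {E : Finset (Sym2 V)} {Y W : Finset V} {u : V} {a b b' : V → Bool}

theorem nbrSign_mul_self : nbrSign E W u a * nbrSign E W u a = 1 := by
  rw [nbrSign, ← Finset.prod_mul_distrib]
  exact Finset.prod_eq_one fun w _ => boolSign_mul_self _

theorem nbrSign_mul_eq_neg_one (h : nbrSign E W u a ≠ nbrSign E W u b) :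
    nbrSign E W u a * nbrSign E W u b = -1 := by
  have hsq : nbrSign E W u a * nbrSign E W u a = nbrSign E W u b * nbrSign E W u b :=
    nbrSign_mul_self.trans nbrSign_mul_self.symm
  rw [(mul_self_eq_mul_self_iff.1 hsq).resolve_left h, neg_mul, nbrSign_mul_self]

theorem eq_of_nbrSign_eq {v : V} (hv : v ∈ W) (huv : s(u, v) ∈ E)
    (hab : ∀ w ∈ W, s(u, w) ∈ E → w ≠ v → a w = b w) (h : nbrSign E W u a = nbrSign E W u b) :
    a v = b v := by
  have hmem : v ∈ ({w ∈ W | s(u, w) ∈ E} : Finset V) := Finset.mem_filter.2 ⟨hv, huv⟩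
  have hrest : ∏ w ∈ ({w ∈ W | s(u, w) ∈ E} : Finset V).erase v, boolSign (a w) =
      ∏ w ∈ ({w ∈ W | s(u, w) ∈ E} : Finset V).erase v, boolSign (b w) :=
    Finset.prod_congr rfl fun w hw => by
      rw [Finset.mem_erase, Finset.mem_filter] at hw
      rw [hab w hw.2.1 hw.2.2 hw.1]
  have hne : ∏ w ∈ ({w ∈ W | s(u, w) ∈ E} : Finset V).erase v, boolSign (b w) ≠ 0 :=
    Finset.prod_ne_zero_iff.2 fun w _ => left_ne_zero_of_mul_eq_one (boolSign_mul_self _)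
  rw [nbrSign, nbrSign, ← Finset.mul_prod_erase _ _ hmem, ← Finset.mul_prod_erase _ _ hmem,
    hrest] at h
  exact boolSign_injective (mul_right_cancel₀ hne h)

variable [Fintype V]

theorem graphSign_flipVar_mul (hu : s(u, u) ∉ E) (a : V → Bool) :
    graphSign E (flipVar u a) * graphSign E a = nbrSign E Finset.univ u a := by
  have hsub : ({w | s(u, w) ∈ E} : Finset V).image (fun w => s(u, w)) ⊆ E := by
    intro e he
    obtain ⟨w, hw, rfl⟩ := Finset.mem_image.1 he
    exact (Finset.mem_filter.1 hw).2
  rw [graphSign, graphSign, nbrSign, ← Finset.prod_mul_distrib, ← Finset.prod_subset hsub,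
    Finset.prod_image fun w _ w' _ h => Sym2.congr_right.1 h]
  · refine Finset.prod_congr rfl fun w hw => ?_
    have hwu : w ≠ u := by
      rintro rfl
      exact hu (Finset.mem_filter.1 hw).2
    cases h : a u <;> cases h' : a w <;> simp [flipVar, hwu, h, h', boolSign]
  · intro e heE he
    have hue : u ∉ e := by
      rintro ⟨w, rfl⟩
      exact he (Finset.mem_image_of_mem _ (by simpa using heE))
    rw [edgeSign_congr (b := a) fun x hx => ?_, edgeSign_mul_self]
    exact Function.update_of_ne (fun hxu => hue (by rwa [← hxu])) _ _

theorem nbrSign_piecewise_mul (a b b' : V → Bool) :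
    nbrSign E Finset.univ u (Y.piecewise a b) * nbrSign E Finset.univ u (Y.piecewise a b') =
      nbrSign E Yᶜ u b * nbrSign E Yᶜ u b' := by
  simp only [nbrSign, ← Finset.prod_mul_distrib]
  refine (Finset.prod_subset_one_on_sdiff (Finset.filter_subset_filter _ (Finset.subset_univ _))
    (fun w hw => ?_) fun w hw => ?_).symm
  · have hwY : w ∈ Y := by
      simp only [Finset.mem_sdiff, Finset.mem_filter, Finset.mem_compl] at hw
      tauto
    simp [hwY, boolSign_mul_self]
  · have hwY : w ∉ Y := Finset.mem_compl.1 (Finset.mem_filter.1 hw).1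
    simp [hwY]

/-- Flipping `u` changes the sign of the summand. -/
theorem sum_graphSign_piecewise_mul_eq_zero (huY : u ∈ Y) (hu : s(u, u) ∉ E)
    (h : nbrSign E Yᶜ u b ≠ nbrSign E Yᶜ u b') :
    ∑ a, graphSign E (Y.piecewise a b) * graphSign E (Y.piecewise a b') = 0 := by
  have hflip (c : V → Bool) :
      graphSign E (flipVar u c) = nbrSign E Finset.univ u c * graphSign E c := by
    rw [← graphSign_flipVar_mul hu, mul_assoc, graphSign_mul_self, mul_one]
  have hterm (a : V → Bool) :
      graphSign E (Y.piecewise (flipVar u a) b) * graphSign E (Y.piecewise (flipVar u a) b') =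
        -(graphSign E (Y.piecewise a b) * graphSign E (Y.piecewise a b')) := by
    rw [piecewise_flipVar huY, piecewise_flipVar huY, hflip, hflip, mul_mul_mul_comm,
      nbrSign_piecewise_mul, nbrSign_mul_eq_neg_one h, neg_one_mul]
  have hsum := Equiv.sum_comp (flipVar_involutive u).toPerm fun a =>
    graphSign E (Y.piecewise a b) * graphSign E (Y.piecewise a b')
  simp only [Function.Involutive.coe_toPerm, hterm, Finset.sum_neg_distrib] at hsum
  exact CharZero.neg_eq_self_iff.1 hsum

/-- The edges `s(u i, v i)`, for `i ∈ L`, form an induced matching in the bipartite graph of all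
edges of `E` between `Y` and its complement. -/
structure IsCrossingInducedMatching {ι : Type*} (E : Finset (Sym2 V)) (Y : Finset V) (L : Finset ι)
    (u v : ι → V) : Prop where
  left_mem : ∀ i ∈ L, u i ∈ Y
  right_mem : ∀ i ∈ L, v i ∈ Yᶜ
  mem_iff : ∀ i ∈ L, ∀ j ∈ L, s(u i, v j) ∈ E ↔ i = j

section Matching

variable {ι : Type*} {L : Finset ι} {u v : ι → V}

theorem IsCrossingInducedMatching.injOn (h : IsCrossingInducedMatching E Y L u v) :
    Set.InjOn v L :=
  fun i hi j hj hij => (h.mem_iff i hi j hj).1 (hij ▸ (h.mem_iff i hi i hi).2 rfl)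

/-- Outside of the `v i` the assignment `b'` can be arbitrary; then each `b' (v i)` is determined by
the sign at `u i`. -/
theorem IsCrossingInducedMatching.card_mul_two_pow_le (h : IsCrossingInducedMatching E Y L u v)
    (b : V → Bool) :
    Finset.card {b' : V → Bool | ∀ i ∈ L, nbrSign E Yᶜ (u i) b = nbrSign E Yᶜ (u i) b'} *
      2 ^ L.card ≤ 2 ^ Fintype.card V := by
  rw [← Finset.card_image_of_injOn h.injOn]
  refine card_mul_two_pow_le_of_eqOn_compl _ _ fun a ha a' ha' hout => funext fun x => ?_
  by_cases hx : x ∈ L.image v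
  · obtain ⟨i, hi, rfl⟩ := Finset.mem_image.1 hx
    refine eq_of_nbrSign_eq (h.right_mem i hi) ((h.mem_iff i hi i hi).2 rfl) (fun w _ hw hne => ?_)
      (((Finset.mem_filter.1 ha).2 i hi).symm.trans ((Finset.mem_filter.1 ha').2 i hi))
    refine hout fun hwv => hne ?_
    obtain ⟨j, hj, rfl⟩ := Finset.mem_image.1 (Finset.mem_coe.1 hwv)
    rw [(h.mem_iff i hi j hj).1 hw]
  · exact hout (by simpa using hx)

theorem IsCrossingInducedMatching.sq_sum_indicator_mul_le (h : IsCrossingInducedMatching E Y L u v)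
    (hE : ∀ i ∈ L, s(u i, u i) ∉ E) {S : Set (V → Bool)} (hS : IsRectangle Y S) :
    (∑ a, S.indicator (graphSign E) a) ^ 2 * 2 ^ L.card ≤ (2 ^ Fintype.card V) ^ 2 := by
  have hterm (b b' : V → Bool) :
      |∑ a, graphSign E (Y.piecewise a b) * graphSign E (Y.piecewise a b')| ≤
        if ∀ i ∈ L, nbrSign E Yᶜ (u i) b = nbrSign E Yᶜ (u i) b' then 2 ^ Fintype.card V
          else 0 := by
    split_ifs with hb
    · refine (Finset.abs_sum_le_sum_abs _ _).trans (le_of_eq ?_)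
      simp [abs_mul, abs_graphSign]
    · push Not at hb
      obtain ⟨i, hi, hne⟩ := hb
      rw [sum_graphSign_piecewise_mul_eq_zero (h.left_mem i hi) (hE i hi) hne, abs_zero]
  have hcard (b : V → Bool) := Nat.cast_le (α := ℤ).2 (h.card_mul_two_pow_le b)
  push_cast at hcard
  refine le_of_mul_le_mul_left (a := (2 : ℤ) ^ Fintype.card V) ?_ (by positivity)
  calc (2 : ℤ) ^ Fintype.card V * ((∑ a, S.indicator (graphSign E) a) ^ 2 * 2 ^ L.card)
      = 2 ^ Fintype.card V * (∑ a, S.indicator (graphSign E) a) ^ 2 * 2 ^ L.card := by ring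
    _ ≤ (∑ b, ∑ b', if ∀ i ∈ L, nbrSign E Yᶜ (u i) b = nbrSign E Yᶜ (u i) b' then
          2 ^ Fintype.card V else 0) * 2 ^ L.card := by
      gcongr
      exact (hS.sq_sum_indicator_le _).trans
        (Finset.sum_le_sum fun b _ => Finset.sum_le_sum fun b' _ => hterm b b')
    _ = ∑ b, 2 ^ Fintype.card V * ((Finset.card {b' : V → Bool | ∀ i ∈ L,
          nbrSign E Yᶜ (u i) b = nbrSign E Yᶜ (u i) b'} : ℤ) * 2 ^ L.card) := by
      rw [Finset.sum_mul]
      refine Finset.sum_congr rfl fun b _ => ?_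
      rw [← Finset.sum_filter, Finset.sum_const, nsmul_eq_mul]
      ring
    _ ≤ ∑ _b : V → Bool, 2 ^ Fintype.card V * 2 ^ Fintype.card V := by
      gcongr with b
      exact hcard b
    _ = 2 ^ Fintype.card V * (2 ^ Fintype.card V) ^ 2 := by
      simp [sq]

theorem IsCrossingInducedMatching.abs_sum_indicator_mul_le
    (h : IsCrossingInducedMatching E Y L u v) (hE : ∀ i ∈ L, s(u i, u i) ∉ E) {k : ℕ}
    (hk : 2 * k ≤ L.card) {S : Set (V → Bool)} (hS : IsRectangle Y S) :
    |∑ a, S.indicator (graphSign E) a| * 2 ^ k ≤ 2 ^ Fintype.card V := by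
  refine le_of_sq_le_sq ?_ (by positivity)
  calc (|∑ a, S.indicator (graphSign E) a| * 2 ^ k) ^ 2
      = (∑ a, S.indicator (graphSign E) a) ^ 2 * 2 ^ (2 * k) := by
        rw [mul_pow, sq_abs, pow_mul']
    _ ≤ (∑ a, S.indicator (graphSign E) a) ^ 2 * 2 ^ L.card := by
      gcongr
      norm_num
    _ ≤ (2 ^ Fintype.card V) ^ 2 := h.sq_sum_indicator_mul_le hE hS

end Matching

end GraphSign

/-! ### Levelled programs -/

theorem BDD.isFree_of_transGen {V : Type*} {B : BDD V}
    (h : ∀ d e, Relation.TransGen B.Edge (.inl d) (.inl e) → B.var d ≠ B.var e) : B.IsFree := by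
  rintro p ⟨hchain, -, -⟩
  have hpairwise : p.Pairwise (Relation.TransGen B.Edge) :=
    (hchain.imp fun _ _ => Relation.TransGen.single).pairwise
  refine hpairwise.filterMap _ ?_
  rintro (d | b) (e | b') hde x hx y hy
  · simp only [nodeVar?, Sum.getLeft?_inl, Option.map_some, Option.some.injEq] at hx hy
    exact hx ▸ hy ▸ h d e hde
  all_goals simp [nodeVar?] at hx hy

/-- A program with finitely many states that reads one variable in each time step; which one may
depend on the current state. It is a uniform description of a layered binary decision diagram. -/
structure LevelledProgram (V : Type*) where
  State : Type
  fintypeState : Fintype State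
  start : State
  length : ℕ
  var : ℕ → State → V
  next : ℕ → State → Bool → State
  out : State → Bool

namespace LevelledProgram

variable {V : Type*} {P : LevelledProgram V}

instance : Fintype P.State := P.fintypeState

/-- The states that can be reached in `t` steps. -/
inductive Reaches (P : LevelledProgram V) : ℕ → P.State → Prop
  | zero : Reaches P 0 P.start
  | succ {t : ℕ} {q : P.State} (b : Bool) : Reaches P t q → Reaches P (t + 1) (P.next t q b)

/-- The state after `t` steps under the assignment `a`. -/
def run (P : LevelledProgram V) (a : V → Bool) : ℕ → P.State
  | 0 => P.start
  | t + 1 => P.next t (P.run a t) (a (P.var t (P.run a t)))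

/-- The Boolean function computed by the program. -/
def eval (P : LevelledProgram V) (a : V → Bool) : Bool := P.out (P.run a P.length)

theorem reaches_run (a : V → Bool) (t : ℕ) : P.Reaches t (P.run a t) := by
  induction t with
  | zero => exact .zero
  | succ t ih => exact .succ _ ih

/-- The relation between a pair of a time and a state and its possible successors. -/
def Step (P : LevelledProgram V) (u v : ℕ × P.State) : Prop :=
  ∃ b, v = (u.1 + 1, P.next u.1 u.2 b)

/-- No variable is read twice on a path of the program, even if no assignment is consistent with
the path. -/
def IsReadOnce (P : LevelledProgram V) : Prop :=
  ∀ u v, v.1 < P.length → Relation.TransGen P.Step u v → P.var u.1 u.2 ≠ P.var v.1 v.2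

/-- The decision nodes of the diagram of a program: a time and a state that is reached then. -/
abbrev Node (P : LevelledProgram V) : Type :=
  {p : Fin P.length × P.State // P.Reaches p.1 p.2}

/-- The node of the diagram at time `t` in state `q`, which is a sink at the end. -/
def node (P : LevelledProgram V) (t : ℕ) (q : P.State) (hq : P.Reaches t q) : P.Node ⊕ Bool :=
  if ht : t < P.length then .inl ⟨(⟨t, ht⟩, q), hq⟩ else .inr (P.out q)

/-- The successor of a decision node. -/
def succ (P : LevelledProgram V) (d : P.Node) (b : Bool) : P.Node ⊕ Bool :=
  P.node (d.1.1 + 1) (P.next d.1.1 d.1.2 b) (d.2.succ b)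

/-- The time of a node; the sinks come last. -/
def layer (P : LevelledProgram V) : P.Node ⊕ Bool → ℕ
  | .inl d => d.1.1
  | .inr _ => P.length

theorem node_of_lt {t : ℕ} (ht : t < P.length) {q : P.State} (hq : P.Reaches t q) :
    P.node t q hq = .inl ⟨(⟨t, ht⟩, q), hq⟩ :=
  dif_pos ht

theorem node_length {q : P.State} (hq : P.Reaches P.length q) :
    P.node P.length q hq = .inr (P.out q) :=
  dif_neg (lt_irrefl _)

theorem layer_node {t : ℕ} (ht : t ≤ P.length) {q : P.State} (hq : P.Reaches t q) :
    P.layer (P.node t q hq) = t := by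
  rcases ht.lt_or_eq with ht | rfl
  · rw [node_of_lt ht]
    rfl
  · rw [node_length]
    rfl

theorem layer_succ (d : P.Node) (b : Bool) : P.layer (P.succ d b) = P.layer (.inl d) + 1 :=
  layer_node d.1.1.2 _

theorem exists_eq_node (h : Function.Surjective P.eval) (v : P.Node ⊕ Bool) :
    ∃ t q, ∃ hq : P.Reaches t q, t ≤ P.length ∧ v = P.node t q hq := by
  rcases v with ⟨⟨⟨t, ht⟩, q⟩, hq⟩ | b
  · exact ⟨t, q, hq, ht.le, (node_of_lt ht hq).symm⟩
  · obtain ⟨a, rfl⟩ := h b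
    exact ⟨P.length, P.run a P.length, reaches_run a _, le_rfl, (node_length _).symm⟩

/-- The sinks have predecessors because both values are taken. -/
theorem eq_node_start_iff (h : Function.Surjective P.eval) (v : P.Node ⊕ Bool) :
    v = P.node 0 P.start .zero ↔ ¬ ∃ d b, v = P.succ d b := by
  constructor
  · rintro rfl ⟨d, b, hv⟩
    have hlayer := congrArg P.layer hv
    rw [layer_node (Nat.zero_le _), layer_succ] at hlayer
    omega
  · intro hv
    obtain ⟨t, q, hq, ht, rfl⟩ := exists_eq_node h v
    cases hq with
    | zero => rfl
    | @succ t q b hq => exact absurd ⟨⟨(⟨t, ht⟩, q), hq⟩, b, rfl⟩ hv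

/-- The binary decision diagram of a program. -/
noncomputable def toBDD (P : LevelledProgram V) (h : Function.Surjective P.eval) : BDD V where
  Decision := P.Node
  fintypeDecision := Fintype.ofFinite _
  var d := P.var d.1.1 d.1.2
  succ := P.succ
  source := P.node 0 P.start .zero
  acyclic := by
    refine Subrelation.wf ?_ (measure fun u => P.length - P.layer u).wf
    rintro v u ⟨d, b, rfl, rfl⟩
    have hd : P.layer (.inl d) < P.length := d.1.1.2
    have := layer_succ d b
    change P.length - P.layer (P.succ d b) < P.length - P.layer (.inl d)
    omega
  source_iff := eq_node_start_iff h

variable (h : Function.Surjective P.eval)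

theorem evalFrom_toBDD_node (a : V → Bool) {t : ℕ} (ht : t ≤ P.length) :
    (P.toBDD h).evalFrom a (P.node t (P.run a t) (reaches_run a t)) =
      (P.toBDD h).evalFrom a (P.toBDD h).source := by
  induction t with
  | zero => rfl
  | succ t ih =>
    rw [← ih (by omega), node_of_lt (show t < P.length from ht)]
    exact ((P.toBDD h).evalFrom_decision a ⟨(⟨t, ht⟩, P.run a t), reaches_run a t⟩).symm

theorem toBDD_computes : (P.toBDD h).Computes P.eval := by
  intro a
  rw [← evalFrom_toBDD_node h a le_rfl, node_length]
  exact (P.toBDD h).evalFrom_sink a _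

theorem size_toBDD_le : (P.toBDD h).size ≤ P.length * Fintype.card P.State + 2 := by
  let := (P.toBDD h).fintypeDecision
  have hcard : Fintype.card (P.toBDD h).Decision ≤ Fintype.card (Fin P.length × P.State) :=
    Fintype.card_le_of_injective (fun d : P.Node => d.1) Subtype.val_injective
  rw [Fintype.card_prod, Fintype.card_fin] at hcard
  exact Nat.add_le_add_right hcard 2

theorem isLayeredOfWidthLE_toBDD :
    (P.toBDD h).IsLayeredOfWidthLE (Fintype.card P.State + 2) := by
  refine ⟨P.layer, ?_, fun i => ?_⟩
  · rintro u v ⟨d, b, rfl, rfl⟩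
    exact layer_succ d b
  let stateOrSink : P.Node ⊕ Bool → P.State ⊕ Bool := Sum.map (fun d => d.1.2) id
  have hinj : Set.InjOn stateOrSink {u | P.layer u = i} := by
    rintro (⟨⟨t, q⟩, hq⟩ | b) hu (⟨⟨t', q'⟩, hq'⟩ | b') hu' heq
    · obtain rfl : t = t' := Fin.ext (Eq.trans hu (Eq.symm hu'))
      obtain rfl : q = q' := Sum.inl_injective heq
      rfl
    · cases heq
    · cases heq
    · exact congrArg Sum.inr (Sum.inr_injective heq)
  calc {u | P.layer u = i}.ncard ≤ (Set.univ : Set (P.State ⊕ Bool)).ncard :=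
        Set.ncard_le_ncard_of_injOn stateOrSink (fun _ _ => Set.mem_univ _) hinj
    _ = Fintype.card P.State + 2 := by simp [Set.ncard_univ]

theorem step_of_succ_eq_inl {d e : P.Node} {b : Bool} (he : P.succ d b = .inl e) :
    P.Step (d.1.1, d.1.2) (e.1.1, e.1.2) := by
  unfold succ node at he
  split_ifs at he
  cases he
  exact ⟨b, rfl⟩

theorem transGen_step_of_transGen_edge {d e : P.Node}
    (hde : Relation.TransGen (P.toBDD h).Edge (.inl d) (.inl e)) :
    Relation.TransGen P.Step (d.1.1, d.1.2) (e.1.1, e.1.2) := by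
  generalize hv : (.inl e : (P.toBDD h).Node) = v at hde
  induction hde generalizing e with
  | single hstep =>
    obtain ⟨_, b, hd, he⟩ := hstep
    obtain rfl := Sum.inl_injective hd
    exact .single (step_of_succ_eq_inl (he.symm.trans hv.symm))
  | tail _ hstep ih =>
    obtain ⟨d', b, hd', he⟩ := hstep
    exact (ih hd'.symm).tail (step_of_succ_eq_inl (he.symm.trans hv.symm))

theorem isFree_toBDD (hP : P.IsReadOnce) : (P.toBDD h).IsFree :=
  BDD.isFree_of_transGen fun _ e hde => hP _ _ e.1.1.2 (transGen_step_of_transGen_edge h hde)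

end LevelledProgram

/-- The state of `pathProgram`: the value of the selector, the value of the quadratic form on the
variables read so far, and the last value read if the next variable is joined to it (`false`
otherwise). -/
structure PathState where
  selector : Bool
  value : Bool
  last : Bool

instance : Fintype PathState :=
  Fintype.ofEquiv (Bool × Bool × Bool)
    { toFun := fun q => ⟨q.1, q.2.1, q.2.2⟩
      invFun := fun q => (q.selector, q.value, q.last)
      left_inv := fun _ => rfl
      right_inv := fun _ => rfl }

section PathProgram

variable {V : Type*} {x : V} {σ : Bool → ℕ → V} {N : ℕ} {I : Finset ℕ}

/-- The program that first reads the selector `x` and then, if its value is `β`, the variables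
`σ β 0, …, σ β (N - 1)`. It sums up modulo 2 the products of the values of `σ β t` and `σ β (t + 1)`
for `t ∈ I`. -/
def pathProgram (x : V) (σ : Bool → ℕ → V) (N : ℕ) (I : Finset ℕ) : LevelledProgram V where
  State := PathState
  fintypeState := inferInstance
  start := ⟨false, false, false⟩
  length := N + 1
  var
    | 0, _ => x
    | t + 1, q => σ q.selector t
  next
    | 0, _, b => ⟨b, false, false⟩
    | t + 1, q, b => ⟨q.selector, xor q.value (q.last && b), decide (t ∈ I) && b⟩
  out := PathState.value

theorem run_pathProgram (a : V → Bool) (t : ℕ) :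
    ∃ s, (pathProgram x σ N I).run a (t + 2) =
        ⟨a x, s, decide (t ∈ I) && a (σ (a x) t)⟩ ∧
      boolSign s = ∏ i ∈ Finset.range t with i ∈ I, edgeSign a s(σ (a x) i, σ (a x) (i + 1)) := by
  induction t with
  | zero => exact ⟨false, rfl, rfl⟩
  | succ t ih =>
    obtain ⟨s, hrun, hs⟩ := ih
    rw [LevelledProgram.run, hrun]
    refine ⟨_, rfl, ?_⟩
    rw [boolSign_xor, hs, Finset.range_add_one, Finset.filter_insert]
    by_cases ht : t ∈ I
    · simp [ht, pathProgram, mul_comm]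
    · simp [ht, boolSign]

theorem boolSign_eval_pathProgram (hI : ∀ t ∈ I, t + 1 < N) (a : V → Bool) :
    boolSign ((pathProgram x σ N I).eval a) =
      ∏ t ∈ I, edgeSign a s(σ (a x) t, σ (a x) (t + 1)) := by
  cases N with
  | zero =>
    obtain rfl : I = ∅ := Finset.eq_empty_of_forall_notMem fun t ht => by simpa using hI t ht
    rfl
  | succ N =>
    obtain ⟨s, hrun, hs⟩ := run_pathProgram (x := x) (σ := σ) (N := N + 1) (I := I) a N
    have hfilter : ({i ∈ Finset.range N | i ∈ I} : Finset ℕ) = I := by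
      ext i
      simpa using fun hi => Nat.lt_of_succ_lt_succ (hI i hi)
    rw [hfilter] at hs
    rw [← hs]
    exact congrArg (fun q : PathState => boolSign q.value) hrun

theorem isReadOnce_pathProgram (hx : ∀ β, ∀ t < N, x ≠ σ β t)
    (hσ : ∀ β, Set.InjOn (σ β) (Set.Iio N)) : (pathProgram x σ N I).IsReadOnce := by
  have hstep {u v : ℕ × PathState} (h : Relation.TransGen (pathProgram x σ N I).Step u v) :
      u.1 < v.1 ∧ (u.1 = 0 ∨ u.2.selector = v.2.selector) := by
    induction h with
    | single h =>
      obtain ⟨b, rfl⟩ := h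
      rcases u with ⟨_ | t, q⟩
      · exact ⟨Nat.one_pos, .inl rfl⟩
      · exact ⟨Nat.lt_succ_self _, .inr rfl⟩
    | @tail v w _ h ih =>
      obtain ⟨b, rfl⟩ := h
      rcases v with ⟨_ | t, q⟩
      · exact absurd ih.1 (Nat.not_lt_zero _)
      · exact ⟨ih.1.trans (Nat.lt_succ_self _), ih.2⟩
  rintro ⟨t, q⟩ ⟨t', q'⟩ ht' h
  obtain ⟨htt', hq⟩ := hstep h
  obtain ⟨t', rfl⟩ : ∃ s, t' = s + 1 := Nat.exists_eq_succ_of_ne_zero (Nat.ne_zero_of_lt htt')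
  have hN : t' < N := Nat.lt_of_succ_lt_succ ht'
  cases t with
  | zero => exact hx _ _ hN
  | succ t =>
    obtain hq : q.selector = q'.selector := hq.resolve_left (Nat.succ_ne_zero t)
    have hlt : t < t' := Nat.lt_of_succ_lt_succ htt'
    change σ q.selector t ≠ σ q'.selector t'
    rw [hq]
    exact fun heq => hlt.ne (hσ _ (hlt.trans hN) hN heq)

end PathProgram

/-! ### The grid function -/

section Grid

variable {K : ℕ} {β : Bool} {T : Finset Bool} {i j i' j' l p q : ℕ}

/-- The variable of a cell of the `K × K` grid: the one in place `j` of line `i`, where the lines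
are the rows if `β` is `false` and the columns if `β` is `true`. The last variable is not in the
grid; it serves as selector between rows and columns. -/
def gridVar (K : ℕ) (β : Bool) (i j : ℕ) : Fin (K * K + 1) :=
  Fin.ofNat _ (if β then j * K + i else i * K + j)

theorem gridVar_not (β : Bool) (i j : ℕ) : gridVar K (!β) i j = gridVar K β j i := by
  cases β <;> rfl

theorem mul_add_lt_mul_self (hi : i < K) (hj : j < K) : i * K + j < K * K := by
  nlinarith

theorem mul_add_div_mod (i : ℕ) (hj : j < K) : (i * K + j) / K = i ∧ (i * K + j) % K = j :=
  (Nat.div_mod_unique (by omega)).2 ⟨by ring, hj⟩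

theorem mul_add_inj_of_lt (hj : j < K) (hj' : j' < K) (h : i * K + j = i' * K + j') :
    i = i' ∧ j = j' := by
  exact ⟨by rw [← (mul_add_div_mod i hj).1, h, (mul_add_div_mod i' hj').1],
    by rw [← (mul_add_div_mod i hj).2, h, (mul_add_div_mod i' hj').2]⟩

theorem val_gridVar (hi : i < K) (hj : j < K) :
    (gridVar K β i j : ℕ) = if β then j * K + i else i * K + j := by
  have := mul_add_lt_mul_self hi hj
  have := mul_add_lt_mul_self hj hi
  exact Nat.mod_eq_of_lt (by split_ifs <;> omega)

theorem gridVar_ne_last (hi : i < K) (hj : j < K) : gridVar K β i j ≠ Fin.last _ := by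
  have := mul_add_lt_mul_self hi hj
  have := mul_add_lt_mul_self hj hi
  rw [Ne, Fin.ext_iff, val_gridVar hi hj, Fin.val_last]
  split_ifs <;> omega

theorem gridVar_inj (hi : i < K) (hj : j < K) (hi' : i' < K) (hj' : j' < K) :
    gridVar K β i j = gridVar K β i' j' ↔ i = i' ∧ j = j' := by
  refine ⟨fun h => ?_, fun ⟨hii', hjj'⟩ => hii' ▸ hjj' ▸ rfl⟩
  rw [Fin.ext_iff, val_gridVar hi hj, val_gridVar hi' hj'] at h
  cases β
  · exact mul_add_inj_of_lt hj hj' h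
  · exact (mul_add_inj_of_lt hi hi' h).symm

theorem exists_gridVar_eq {y : Fin (K * K + 1)} (hy : y ≠ Fin.last _) :
    ∃ i < K, ∃ j < K, gridVar K false i j = y := by
  have hlt : (y : ℕ) < K * K := Fin.val_lt_last hy
  have hK : 0 < K := Nat.pos_of_mul_pos_left ((Nat.zero_le _).trans_lt hlt)
  have hi : (y : ℕ) / K < K := Nat.div_lt_of_lt_mul hlt
  refine ⟨y / K, hi, y % K, Nat.mod_lt _ hK, Fin.ext ?_⟩
  rw [val_gridVar hi (Nat.mod_lt _ hK)]
  exact Nat.div_add_mod' _ _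

/-- The pairs of a line and a place in it that is not the last one. -/
def linePlaces (K : ℕ) : Finset (ℕ × ℕ) := Finset.range K ×ˢ Finset.range (K - 1)

theorem mem_linePlaces : (i, j) ∈ linePlaces K ↔ i < K ∧ j + 1 < K := by
  rw [linePlaces, Finset.mem_product, Finset.mem_range, Finset.mem_range]
  omega

/-- The edge between two consecutive cells of a line. -/
def gridEdge (K : ℕ) (e : Bool × ℕ × ℕ) : Sym2 (Fin (K * K + 1)) :=
  s(gridVar K e.1 e.2.1 e.2.2, gridVar K e.1 e.2.1 (e.2.2 + 1))

/-- The edges of the grid in the directions that belong to `T`. -/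
def gridEdges (K : ℕ) (T : Finset Bool) : Finset (Sym2 (Fin (K * K + 1))) :=
  (T ×ˢ linePlaces K).image (gridEdge K)

theorem mem_gridEdges {e : Sym2 (Fin (K * K + 1))} :
    e ∈ gridEdges K T ↔
      ∃ β ∈ T, ∃ i j, i < K ∧ j + 1 < K ∧ s(gridVar K β i j, gridVar K β i (j + 1)) = e := by
  simp only [gridEdges, Finset.mem_image, Finset.mem_product, Prod.exists, mem_linePlaces,
    gridEdge]
  tauto

theorem gridEdge_injOn : Set.InjOn (gridEdge K) (T ×ˢ linePlaces K : Finset _) := by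
  rintro ⟨β, i, j⟩ he ⟨β', i', j'⟩ he' h
  obtain ⟨-, hi, hj⟩ : β ∈ T ∧ i < K ∧ j + 1 < K := by simpa [mem_linePlaces] using he
  obtain ⟨-, hi', hj'⟩ : β' ∈ T ∧ i' < K ∧ j' + 1 < K := by simpa [mem_linePlaces] using he'
  rcases Bool.eq_or_eq_not β' β with rfl | rfl
  · simp only [gridEdge, Sym2.eq_iff, gridVar_inj, *, Nat.lt_of_succ_lt] at h
    have : i = i' ∧ j = j' := by omega
    simp [this]
  · simp only [gridEdge, gridVar_not, Sym2.eq_iff, gridVar_inj, *, Nat.lt_of_succ_lt] at h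
    omega

theorem graphSign_gridEdges (K : ℕ) (T : Finset Bool) (a : Fin (K * K + 1) → Bool) :
    graphSign (gridEdges K T) a =
      ∏ β ∈ T, ∏ e ∈ linePlaces K, edgeSign a (gridEdge K (β, e)) := by
  rw [graphSign, gridEdges, Finset.prod_image gridEdge_injOn, Finset.prod_product]

theorem notMem_gridEdges_diag (u : Fin (K * K + 1)) : s(u, u) ∉ gridEdges K T := by
  rw [mem_gridEdges]
  rintro ⟨β, -, i, j, hi, hj, he⟩
  simp only [Sym2.eq_iff, or_self] at he
  have := ((gridVar_inj hi (Nat.lt_of_succ_lt hj) hi hj).1 (he.1.trans he.2.symm)).2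
  omega

theorem mk_gridVar_mem_gridEdges (hβ : β ∈ T) (hl : l < K) (hp : p < K) (hq : q < K)
    (hpq : q = p + 1 ∨ p = q + 1) : s(gridVar K β l p, gridVar K β l q) ∈ gridEdges K T := by
  rw [mem_gridEdges]
  rcases hpq with rfl | rfl
  · exact ⟨β, hβ, l, p, hl, hq, rfl⟩
  · exact ⟨β, hβ, l, q, hl, hp, Sym2.eq_swap⟩

theorem line_eq_or_adjacent_of_mem_gridEdges (hi : i < K) (hp : p < K) (hi' : i' < K) (hq : q < K)
    (h : s(gridVar K β i p, gridVar K β i' q) ∈ gridEdges K T) :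
    i = i' ∨ i' = i + 1 ∨ i = i' + 1 := by
  obtain ⟨β', -, l, t, hl, ht, he⟩ := mem_gridEdges.1 h
  rcases Bool.eq_or_eq_not β' β with rfl | rfl <;>
  · simp only [gridVar_not, Sym2.eq_iff, gridVar_inj, *, Nat.lt_of_succ_lt] at he
    omega

/-- The line `l` meets both `Y` and its complement. -/
def IsMixedLine (K : ℕ) (β : Bool) (Y : Finset (Fin (K * K + 1))) (l : ℕ) : Prop :=
  (∃ j < K, gridVar K β l j ∈ Y) ∧ ∃ j < K, gridVar K β l j ∉ Y

variable {Y : Finset (Fin (K * K + 1))} {S : Set (Fin (K * K + 1) → Bool)}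

theorem IsMixedLine.exists_adjacent (h : IsMixedLine K β Y l) :
    ∃ p < K, ∃ q < K, (q = p + 1 ∨ p = q + 1) ∧ gridVar K β l p ∈ Y ∧ gridVar K β l q ∉ Y := by
  obtain ⟨⟨j, hj, hjY⟩, j', hj', hjY'⟩ := h
  by_contra! hno
  have hconst (t : ℕ) (ht : t < K) : gridVar K β l t ∈ Y ↔ gridVar K β l 0 ∈ Y := by
    induction t with
    | zero => rfl
    | succ t ih =>
      rw [← ih (by omega)]
      exact ⟨fun h => hno _ ht t (by omega) (.inr rfl) h,
        fun h => hno t (by omega) _ ht (.inl rfl) h⟩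
  exact hjY' ((hconst j' hj').2 ((hconst j hj).1 hjY))

theorem exists_subset_succ_notMem (M : Finset ℕ) :
    ∃ L ⊆ M, M.card ≤ 2 * L.card ∧ ∀ l ∈ L, l + 1 ∉ L := by
  have hcard := M.card_filter_add_card_filter_not (fun l => Even l)
  by_cases h : M.card ≤ 2 * (M.filter fun l => Even l).card
  · exact ⟨_, M.filter_subset _, h, by simp +contextual [Nat.even_add_one]⟩
  · exact ⟨M.filter fun l => ¬ Even l, M.filter_subset _, by omega,
      by simp +contextual⟩

/-- Each line of `L` contributes an edge between `Y` and its complement. Two such edges from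
different lines could only be joined by an edge of the other direction, which leads to the next
line. -/
theorem exists_isCrossingInducedMatching (hβ : β ∈ T) {L : Finset ℕ}
    (hL : ∀ l ∈ L, l < K ∧ IsMixedLine K β Y l) (hsucc : ∀ l ∈ L, l + 1 ∉ L) :
    ∃ u v : ℕ → Fin (K * K + 1), IsCrossingInducedMatching (gridEdges K T) Y L u v := by
  choose! p hp q hq hpq hpY hqY using fun l hl => (hL l hl).2.exists_adjacent
  refine ⟨fun l => gridVar K β l (p l), fun l => gridVar K β l (q l), hpY,
    fun l hl => Finset.mem_compl.2 (hqY l hl), fun l hl l' hl' => ⟨fun h => ?_, ?_⟩⟩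
  · rcases line_eq_or_adjacent_of_mem_gridEdges (hL l hl).1 (hp l hl) (hL l' hl').1 (hq l' hl') h
      with h | rfl | rfl
    · exact h
    · exact absurd hl' (hsucc l hl)
    · exact absurd hl (hsucc l' hl')
  · rintro rfl
    exact mk_gridVar_mem_gridEdges hβ (hL l hl).1 (hp l hl) (hq l hl) (hpq l hl)

theorem abs_sum_indicator_gridEdges_mul_le (hβ : β ∈ T) {M : Finset ℕ}
    (hM : ∀ l ∈ M, l < K ∧ IsMixedLine K β Y l) {k : ℕ} (hk : 4 * k ≤ M.card)
    (hS : IsRectangle Y S) :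
    |∑ a, S.indicator (graphSign (gridEdges K T)) a| * 2 ^ k ≤ 2 ^ (K * K + 1) := by
  obtain ⟨L, hLM, hcard, hsucc⟩ := exists_subset_succ_notMem M
  obtain ⟨u, v, huv⟩ :=
    exists_isCrossingInducedMatching hβ (fun l hl => hM l (hLM hl)) hsucc
  simpa using huv.abs_sum_indicator_mul_le (fun i _ => notMem_gridEdges_diag _) (by omega) hS

/-- Every line is mixed with respect to the set of all first places. -/
theorem abs_sum_gridEdges_mul_le (hβ : β ∈ T) (hK : 2 ≤ K) {k : ℕ} (hk : 4 * k ≤ K) :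
    |∑ a, graphSign (gridEdges K T) a| * 2 ^ k ≤ 2 ^ (K * K + 1) := by
  have hmixed (l : ℕ) (hl : l ∈ Finset.range K) :
      l < K ∧ IsMixedLine K β ((Finset.range K).image fun i => gridVar K β i 0) l := by
    rw [Finset.mem_range] at hl
    refine ⟨hl, ⟨0, by omega, Finset.mem_image_of_mem _ (Finset.mem_range.2 hl)⟩, 1, hK, ?_⟩
    simp only [Finset.mem_image, Finset.mem_range, not_exists, not_and]
    intro i hi h
    have := (gridVar_inj hi (by omega) hl hK).1 h
    omega
  simpa using abs_sum_indicator_gridEdges_mul_le hβ hmixed (S := Set.univ) (by simpa using hk)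
    (fun _ _ _ _ _ _ _ => Set.mem_univ _)

theorem card_le_of_mem_rows {Z : Finset (Fin (K * K + 1))} {M : Finset ℕ}
    (h : ∀ i < K, ∀ j < K, gridVar K false i j ∈ Z → i ∈ M) : Z.card ≤ M.card * K + 1 := by
  have hsub : Z ⊆ insert (Fin.last _)
      ((M ×ˢ Finset.range K).image fun c => gridVar K false c.1 c.2) := by
    intro y hy
    by_cases hlast : y = Fin.last _
    · exact hlast ▸ Finset.mem_insert_self _ _
    · obtain ⟨i, hi, j, hj, rfl⟩ := exists_gridVar_eq hlast
      exact Finset.mem_insert_of_mem (Finset.mem_image.2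
        ⟨(i, j), Finset.mem_product.2 ⟨h i hi j hj hy, Finset.mem_range.2 hj⟩, rfl⟩)
  calc Z.card ≤ _ := Finset.card_le_card hsub
    _ ≤ ((M ×ˢ Finset.range K).image fun c => gridVar K false c.1 c.2).card + 1 :=
      Finset.card_insert_le _ _
    _ ≤ M.card * K + 1 := by
      gcongr
      exact Finset.card_image_le.trans (by simp)

/-- If one row is contained in `Y` and another one in the complement, then all columns are mixed.
Otherwise `Y` or its complement is covered, up to the selector, by the mixed rows. -/
theorem IsBalanced.exists_isMixedLine (hY : IsBalanced Y) (hK : 3 ≤ K) :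
    ∃ β, ∃ M : Finset ℕ, (∀ l ∈ M, l < K ∧ IsMixedLine K β Y l) ∧ K ≤ 3 * M.card := by
  classical
  obtain ⟨hlow, hhigh⟩ := hY
  rw [Fintype.card_fin] at hlow hhigh
  let M : Finset ℕ := {l ∈ Finset.range K | IsMixedLine K false Y l}
  have hM (l : ℕ) (hl : l ∈ M) : l < K ∧ IsMixedLine K false Y l := by simpa [M] using hl
  by_cases hin : ∃ i < K, ∀ j < K, gridVar K false i j ∈ Y
  · by_cases hout : ∃ i < K, ∀ j < K, gridVar K false i j ∉ Y
    · obtain ⟨i, hi, hiY⟩ := hin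
      obtain ⟨i', hi', hiY'⟩ := hout
      refine ⟨true, Finset.range K, fun l hl => ?_, by simp; omega⟩
      rw [Finset.mem_range] at hl
      exact ⟨hl, ⟨i, hi, hiY l hl⟩, i', hi', hiY' l hl⟩
    · push Not at hout
      have hcard : Yᶜ.card ≤ M.card * K + 1 := card_le_of_mem_rows fun i hi j hj hij =>
        Finset.mem_filter.2 ⟨Finset.mem_range.2 hi, hout i hi, j, hj, Finset.mem_compl.1 hij⟩
      rw [Finset.card_compl, Fintype.card_fin] at hcard
      exact ⟨false, M, hM, by by_contra!; nlinarith [show K * K ≤ 3 * (M.card * K) + 2 by omega]⟩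
  · push Not at hin
    have hcard : Y.card ≤ M.card * K + 1 := card_le_of_mem_rows fun i hi j hj hij =>
      Finset.mem_filter.2 ⟨Finset.mem_range.2 hi, ⟨j, hj, hij⟩, hin i hi⟩
    exact ⟨false, M, hM, by by_contra!; nlinarith⟩

theorem IsBalancedRectangle.abs_sum_indicator_gridEdges_mul_le (hS : IsBalancedRectangle S)
    (hK : 3 ≤ K) {k : ℕ} (hk : 12 * k ≤ K) :
    |∑ a, S.indicator (graphSign (gridEdges K Finset.univ)) a| * 2 ^ k ≤ 2 ^ (K * K + 1) := by
  obtain ⟨Y, hY, hSY⟩ := hS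
  obtain ⟨β, M, hM, hcard⟩ := hY.exists_isMixedLine hK
  exact _root_.abs_sum_indicator_gridEdges_mul_le (Finset.mem_univ β) hM (by omega) hSY

/-- The program that reads the grid row by row or column by column, depending on the value of the
selector. -/
def gridProgram (K : ℕ) : LevelledProgram (Fin (K * K + 1)) :=
  pathProgram (Fin.last _) (fun β t => gridVar K β (t / K) (t % K)) (K * K)
    ((linePlaces K).image fun e => e.1 * K + e.2)

/-- The sum modulo 2, over the rows or over the columns of the grid, depending on the value of the
selector, of the products of the values of any two consecutive cells. -/
def gridFun (K : ℕ) : (Fin (K * K + 1) → Bool) → Bool :=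
  (gridProgram K).eval

theorem boolSign_gridFun (a : Fin (K * K + 1) → Bool) :
    boolSign (gridFun K a) = graphSign (gridEdges K {a (Fin.last _)}) a := by
  have hI (t : ℕ) (ht : t ∈ (linePlaces K).image fun e => e.1 * K + e.2) : t + 1 < K * K := by
    obtain ⟨⟨i, j⟩, he, rfl⟩ := Finset.mem_image.1 ht
    obtain ⟨hi, hj⟩ := mem_linePlaces.1 he
    exact mul_add_lt_mul_self hi hj
  rw [graphSign_gridEdges, Finset.prod_singleton, gridFun, gridProgram,
    boolSign_eval_pathProgram hI, Finset.prod_image]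
  · refine Finset.prod_congr rfl fun ⟨i, j⟩ he => ?_
    obtain ⟨-, hj⟩ := mem_linePlaces.1 he
    obtain ⟨hdiv, hmod⟩ := mul_add_div_mod i (Nat.lt_of_succ_lt hj)
    obtain ⟨hdiv', hmod'⟩ := mul_add_div_mod i hj
    rw [hdiv, hmod, add_assoc, hdiv', hmod', gridEdge]
  · rintro ⟨i, j⟩ he ⟨i', j'⟩ he' h
    have hj := Nat.lt_of_succ_lt (mem_linePlaces.1 he).2
    have hj' := Nat.lt_of_succ_lt (mem_linePlaces.1 he').2
    exact Prod.ext_iff.2 (mul_add_inj_of_lt hj hj' h)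

theorem boolSign_gridFun_update (a : Fin (K * K + 1) → Bool) (β : Bool) :
    boolSign (gridFun K (Function.update a (Fin.last _) β)) = graphSign (gridEdges K {β}) a := by
  rw [boolSign_gridFun, Function.update_self]
  refine graphSign_congr fun e he x hx => Function.update_of_ne ?_ _ _
  obtain ⟨β, -, i, j, hi, hj, rfl⟩ := mem_gridEdges.1 he
  rcases Sym2.mem_iff.1 hx with rfl | rfl
  · exact gridVar_ne_last hi (Nat.lt_of_succ_lt hj)
  · exact gridVar_ne_last hi hj

theorem gridFun_surjective (hK : 4 ≤ K) : Function.Surjective (gridFun K) := by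
  intro b
  by_contra! hb
  have hconst (a : Fin (K * K + 1) → Bool) : graphSign (gridEdges K {true}) a = boolSign (!b) := by
    rw [← boolSign_gridFun_update, Bool.eq_not.2 (hb _)]
  have hsum := abs_sum_gridEdges_mul_le (Finset.mem_singleton_self true) (by omega)
    (show 4 * 1 ≤ K from hK)
  have habs : |boolSign (!b)| = 1 := by cases b <;> rfl
  simp [hconst, abs_mul, habs] at hsum

theorem exists_bdd_gridFun (hK : 4 ≤ K) : ∃ B : BDD (Fin (K * K + 1)), B.IsFree ∧
    B.Computes (gridFun K) ∧ B.size ≤ (K * K + 1) * 8 + 2 ∧ B.IsLayeredOfWidthLE 10 := by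
  have hmod (t : ℕ) : t % K < K := Nat.mod_lt _ (by omega)
  have hreadOnce : (gridProgram K).IsReadOnce := by
    refine isReadOnce_pathProgram (fun β t ht => ?_) fun β t ht t' ht' h => ?_
    · exact (gridVar_ne_last (Nat.div_lt_of_lt_mul ht) (hmod t)).symm
    · obtain ⟨hdiv, hmod⟩ := (gridVar_inj (Nat.div_lt_of_lt_mul ht) (hmod t)
        (Nat.div_lt_of_lt_mul ht') (hmod t')).1 h
      rw [← Nat.div_add_mod' t K, hdiv, hmod, Nat.div_add_mod']
  have hsurj : Function.Surjective (gridProgram K).eval := gridFun_surjective hK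
  exact ⟨(gridProgram K).toBDD hsurj, LevelledProgram.isFree_toBDD hsurj hreadOnce,
    LevelledProgram.toBDD_computes hsurj, LevelledProgram.size_toBDD_le hsurj,
    LevelledProgram.isLayeredOfWidthLE_toBDD hsurj⟩

theorem four_mul_ite_or_boolSign_mul (b c : Bool) :
    4 * (if (b || c) = true then boolSign b * boolSign c else 0) =
      3 * (boolSign b * boolSign c) - boolSign b - boolSign c - 1 := by
  cases b <;> cases c <;> rfl

theorem four_mul_indicator_existsVar_gridFun (a : Fin (K * K + 1) → Bool) :
    4 * {a | existsVar (Fin.last _) (gridFun K) a = true}.indicator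
        (graphSign (gridEdges K Finset.univ)) a =
      3 * graphSign (gridEdges K Finset.univ) a - graphSign (gridEdges K {false}) a -
        graphSign (gridEdges K {true}) a - 1 := by
  have huniv : graphSign (gridEdges K Finset.univ) a =
      graphSign (gridEdges K {false}) a * graphSign (gridEdges K {true}) a := by
    simp only [graphSign_gridEdges, Fintype.prod_bool, Finset.prod_singleton, mul_comm]
  rw [Set.indicator_apply, huniv, ← boolSign_gridFun_update, ← boolSign_gridFun_update]
  convert four_mul_ite_or_boolSign_mul _ _
  exact Iff.rfl

theorem NNF.IsDDNNF.two_pow_le_of_computes_existsVar_gridFun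
    {D : NNF (Fin (K * K + 1))} (hD : D.IsDDNNF)
    (hf : D.Computes (existsVar (Fin.last _) (gridFun K))) (hK : 3 ≤ K) {k : ℕ} (hk : 12 * k ≤ K) :
    2 ^ k ≤ 4 * D.size ^ 2 + 5 := by
  let Φ (T : Finset Bool) : ℤ := ∑ a, graphSign (gridEdges K T) a
  let A : ℤ := ∑ a, {a | D.GateTrue a D.output}.indicator (graphSign (gridEdges K Finset.univ)) a
  have hΦ {β : Bool} {T : Finset Bool} (hβ : β ∈ T) : |Φ T| * 2 ^ k ≤ 2 ^ (K * K + 1) :=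
    abs_sum_gridEdges_mul_le hβ (by omega) (by omega)
  have hA : |A| * 2 ^ k ≤ D.size ^ 2 * 2 ^ (K * K + 1) := by
    have hδ := hD.abs_sum_indicator_le (by rw [Fintype.card_fin]; nlinarith)
      fun S hS => (Int.le_ediv_iff_mul_le (by positivity)).2
        (hS.abs_sum_indicator_gridEdges_mul_le hK hk)
    calc |A| * 2 ^ k ≤ D.size ^ 2 * (2 ^ (K * K + 1) / 2 ^ k) * 2 ^ k := by gcongr
      _ ≤ D.size ^ 2 * 2 ^ (K * K + 1) := by
        rw [mul_assoc]
        gcongr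
        exact Int.ediv_mul_le _ (by positivity)
  have hsum : 4 * A = 3 * Φ Finset.univ - Φ {false} - Φ {true} - 2 ^ (K * K + 1) := by
    have hset : {a | D.GateTrue a D.output} =
        {a | existsVar (Fin.last _) (gridFun K) a = true} := Set.ext hf
    simp only [A, Φ, hset, Finset.mul_sum, four_mul_indicator_existsVar_gridFun,
      Finset.sum_sub_distrib]
    simp
  have hbound : (2 : ℤ) ^ (K * K + 1) * 2 ^ k ≤ 2 ^ (K * K + 1) * (4 * D.size ^ 2 + 5) := by
    have hpow : (0 : ℤ) < 2 ^ k := by positivity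
    have huniv := hΦ (Finset.mem_univ true)
    have hrows := hΦ (Finset.mem_singleton_self false)
    have hcols := hΦ (Finset.mem_singleton_self true)
    have habs : 2 ^ (K * K + 1) ≤ 4 * |A| + 3 * |Φ Finset.univ| + |Φ {false}| + |Φ {true}| := by
      linarith [neg_abs_le A, le_abs_self (Φ Finset.univ), neg_abs_le (Φ {false}),
        neg_abs_le (Φ {true})]
    linarith [mul_le_mul_of_nonneg_right habs hpow.le]
  exact_mod_cast le_of_mul_le_mul_left hbound (by positivity)

end Grid

theorem le_of_pow_four_le_four_mul_sq_add {s y : ℕ} (hy : 2 ≤ y) (h : y ^ 4 ≤ 4 * s ^ 2 + 5) :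
    y ≤ s := by
  by_contra! hlt
  have hsq : (s + 1) ^ 2 ≤ y ^ 2 := Nat.pow_le_pow_left hlt 2
  have hpow : 4 * y ^ 2 ≤ y ^ 4 := by nlinarith [sq_nonneg y]
  nlinarith

theorem mainTheorem10 :
    ∃ (C W : ℕ) (c : ℝ) (n₀ : ℕ), 0 < c ∧
      ∀ n : ℕ, 1 ≤ n →
        ∃ (m : ℕ) (f : (Fin m → Bool) → Bool) (x : Fin m),
          m ≤ C * n ^ 2 ∧
          (∃ B : BDD (Fin m), B.IsFree ∧ B.Computes f ∧ B.size ≤ C * n ^ 2 ∧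
            B.IsLayeredOfWidthLE W) ∧
          (n₀ ≤ n → ∀ D : NNF (Fin m), D.IsDDNNF → D.Computes (existsVar x f) →
            (2 : ℝ) ^ (c * (n : ℝ)) ≤ (D.size : ℝ)) := by
  refine ⟨8 * 48 ^ 2 + 10, 10, 1, 1, one_pos, fun n hn => ?_⟩
  obtain ⟨B, hfree, hB, hsize, hwidth⟩ := exists_bdd_gridFun (K := 48 * n) (by omega)
  refine ⟨48 * n * (48 * n) + 1, gridFun (48 * n), Fin.last _, by nlinarith,
    ⟨B, hfree, hB, by nlinarith, hwidth⟩, fun _ D hD hf => ?_⟩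
  have hbound : (2 ^ n) ^ 4 ≤ 4 * D.size ^ 2 + 5 := by
    rw [← pow_mul, mul_comm]
    exact hD.two_pow_le_of_computes_existsVar_gridFun hf (by omega) (by omega)
  have hle : 2 ^ n ≤ D.size :=
    le_of_pow_four_le_four_mul_sq_add (Nat.le_self_pow (by omega) 2) hbound
  rw [one_mul, Real.rpow_natCast]
  exact_mod_cast hle
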